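/- Let $K'\subset\mathbb R^d$ be convex and compact, and let $q:U\to q(U)$ be a $C^3$-diffeomorphism between open subsets of $\mathbb R^d$, with $K'\subset U$, whose Jacobian matrix $J_q(u)$ is diagonal for every $u\in U$. Assume that $K:=q(K')$ is convex and compact. Then there is a function $R:\mathbb R^d\to\mathbb R$ such that: 1. $R$ is $C^3$ on a neighbourhood of $K$, strongly convex on $K$ (for the Euclidean norm, with some constant $m>0$), and its Bregman divergence $D_R(x\|y)=R(x)-R(y)-\nabla R(y)^\top(x-y)$ is bounded above on $K\times K$; 2. $q$ maps $K'$ bijectively onto $K$ and $[\nabla^2R(q(u))]^{-1}=J_q(u)J_q(u)^\top$ for all $u\in K'$; 3. $R(x)=\sum_{i=1}^d R_i(x_i)$ is separable, on a neighbourhood of $K'$ one has $q(u)=(q_1(u_1),\dots,q_d(u_d))$, and for each $i$ the functions $q_i$ and $R_i$ are $C^3$ near every point $s$ of $\{u_i:u\in K'\}$, respectively near $q_i(s)$, and $\tilde R_i:=R_i\circ q_i$ solves the scalar linear equation $q_i'\tilde R_i''-q_i''\tilde R_i'-q_i'=0$ on $\{u_i:u\in K'\}$; 4. for all $G_F\ge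 0$ and $c>0$ there is a constant $C$ (depending only on $K'$, $q$, $G_F$, $c$) such that the following holds for every $T\ge1$. Let $\tilde f_1,\dots,\tilde f_T:\mathbb R^d\to\mathbb R$ be losses, not necessarily convex, that are differentiable at every $u\in K'$ with $\|\nabla\tilde f_t(u)\|_2\le G_F$ there, and that satisfy $\tilde f_t(u)=f_t(q(u))$ on $K'$ for functions $f_t$ that are convex on $K$. Then $K$, $R$ and $f_1,\dots,f_T$ form an online mirror descent problem: $K$ is convex and compact, each $f_t$ is convex and differentiable on $K$ (relative to $K$), and $R$ is a regularizer as in 1. Moreover online gradient descent with step size $\eta=c\,T^{-2/3}$, that is, $u_1\in K'$ arbitrary and $u_{t+1}=\Pi_{K'}\bigl(u_t-\eta\nabla\tilde f_t(u_t)\bigr)$ with the Euclidean projection $\Pi_{K'}$, satisfies $$\sum_{t=1}^T\tilde f_t(u_t)-\min_{u\in K'}\sum_{t=1}^T\tilde f_t(u)\le C\,T^{2/3}.$$ -/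

import Mathlib

noncomputable section

/-- `ℝ^d` with the Euclidean norm. -/
abbrev Vec (d : ℕ) : Type := EuclideanSpace ℝ (Fin d)

/-- The Jacobian matrix of `q` at `u`, with entries `∂ q_i / ∂ u_j`. -/
def jacobianMatrix {d : ℕ} (q : Vec d → Vec d) (u : Vec d) : Matrix (Fin d) (Fin d) ℝ :=
  Matrix.of fun i j => fderiv ℝ q u (EuclideanSpace.single j 1) i

/-- The Hessian matrix of `R` at `x`. -/
def hessianMatrix {d : ℕ} (R : Vec d → ℝ) (x : Vec d) : Matrix (Fin d) (Fin d) ℝ :=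
  Matrix.of fun i j =>
    fderiv ℝ (fderiv ℝ R) x (EuclideanSpace.single i 1) (EuclideanSpace.single j 1)

/-- The Bregman divergence `D_R(x ‖ y)`. -/
def bregmanDiv {d : ℕ} (R : Vec d → ℝ) (x y : Vec d) : ℝ :=
  R x - R y - inner ℝ (gradient R y) (x - y)

/-- `R` is a regularizer on `K`: it is `C³` on a neighbourhood of `K`, strongly convex on `K`
with respect to the Euclidean norm, and `K` has bounded diameter for its Bregman divergence. -/
structure IsRegularizer {d : ℕ} (K : Set (Vec d)) (R : Vec d → ℝ) : Prop where
  smooth : ∃ V : Set (Vec d), IsOpen V ∧ K ⊆ V ∧ ContDiffOn ℝ 3 R V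
  strongConvex : ∃ m : ℝ, 0 < m ∧ StrongConvexOn K m R
  bounded : ∃ D : ℝ, ∀ x ∈ K, ∀ y ∈ K, bregmanDiv R x y ≤ D

/-- The domain `K`, the losses `f 1, …, f T` and `R` form an online mirror descent problem:
convex domain, losses that are convex and differentiable on it, and a regularizer. -/
structure IsOMDObject {d : ℕ} (K : Set (Vec d)) (R : Vec d → ℝ) (T : ℕ)
    (f : ℕ → Vec d → ℝ) : Prop where
  convex_domain : Convex ℝ K
  compact_domain : IsCompact K
  convex_loss : ∀ t ∈ Finset.Icc 1 T, ConvexOn ℝ K (f t)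
  differentiable_loss : ∀ t ∈ Finset.Icc 1 T, DifferentiableOn ℝ (f t) K
  regularizer : IsRegularizer K R

/-- `q` maps `K'` bijectively onto `K`, and `[∇²R(x)]⁻¹ = J_q(u) J_q(u)ᵀ` at `x = q(u)`. -/
def HessianJacobianRelation {d : ℕ} (q : Vec d → Vec d) (K' K : Set (Vec d))
    (R : Vec d → ℝ) : Prop :=
  Set.BijOn q K' K ∧
    ∀ u ∈ K', (hessianMatrix R (q u))⁻¹ = jacobianMatrix q u * (jacobianMatrix q u).transpose

/-- `R` is separable, `R(x) = ∑ i, ρ_i(x_i)`, near `K'` the map `q` acts coordinatewise,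
`q(u)_i = κ_i(u_i)`, and each `ρ̃_i = ρ_i ∘ κ_i` solves the linear scalar equation
`κ_i' ρ̃_i'' - κ_i'' ρ̃_i' - κ_i' = 0` on the projection of `K'` to the `i`-th axis. -/
def SolvesCoordinateODEs {d : ℕ} (q : Vec d → Vec d) (K' : Set (Vec d))
    (R : Vec d → ℝ) : Prop :=
  ∃ κ ρ : Fin d → ℝ → ℝ,
    (∃ N : Set (Vec d), IsOpen N ∧ K' ⊆ N ∧ ∀ u ∈ N, ∀ i, q u i = κ i (u i)) ∧
    (∀ x, R x = ∑ i, ρ i (x i)) ∧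
    ∀ i, ∀ s ∈ (fun u : Vec d => u i) '' K',
      ContDiffAt ℝ 3 (κ i) s ∧ ContDiffAt ℝ 3 (ρ i) (κ i s) ∧
      deriv (κ i) s * deriv (deriv (ρ i ∘ κ i)) s
        - deriv (deriv (κ i)) s * deriv (ρ i ∘ κ i) s - deriv (κ i) s = 0

/-- The loss `g` is `f ∘ q` on `K'` with `f` convex on `q(K')`, and `g` is differentiable with
gradient bounded by `GF` on `K'`. -/
structure IsReparametrizedLoss {d : ℕ} (q : Vec d → Vec d) (K' : Set (Vec d)) (GF : ℝ)
    (g f : Vec d → ℝ) : Prop where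
  convex : ConvexOn ℝ (q '' K') f
  comp_eq : ∀ u ∈ K', g u = f (q u)
  differentiable : ∀ u ∈ K', DifferentiableAt ℝ g u
  gradient_le : ∀ u ∈ K', ‖gradient g u‖ ≤ GF

/-- `p` is the Euclidean projection of `v` to `K`. -/
def IsEuclideanProjection {d : ℕ} (K : Set (Vec d)) (v p : Vec d) : Prop :=
  p ∈ K ∧ ∀ z ∈ K, ‖v - p‖ ≤ ‖v - z‖

/-- `u 1, …, u (T + 1)` are iterates of projected online gradient descent on the losses
`g 1, …, g T` with step size `η`, started at an arbitrary point of `K`. -/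
def IsOGDRun {d : ℕ} (K : Set (Vec d)) (η : ℝ) (T : ℕ) (g : ℕ → Vec d → ℝ)
    (u : ℕ → Vec d) : Prop :=
  u 1 ∈ K ∧ ∀ t ∈ Finset.Icc 1 T,
    IsEuclideanProjection K (u t - η • gradient (g t) (u t)) (u (t + 1))

/-- The regret of the plays `u 1, …, u T` against the best fixed point of `K`. -/
def regret {d : ℕ} (K : Set (Vec d)) (T : ℕ) (g : ℕ → Vec d → ℝ) (u : ℕ → Vec d) : ℝ :=
  (∑ t ∈ Finset.Icc 1 T, g t (u t)) - sInf ((fun v => ∑ t ∈ Finset.Icc 1 T, g t v) '' K)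

end

noncomputable section

open Set Filter Topology

/-! ### One-sided difference quotients and projected gradient steps -/

/-! A diagonal Jacobian makes `q` act coordinatewise near the convex set `K'`, and its inverse does
the same near `K` (`exists_coordinate_functions`). Writing `ψ i` for the coordinates of the inverse,
integrate `(ψ i)' ^ 2` twice to get `ρ i` and let `R` be their sum. Its Hessian is then diagonal
with entries `(ψ i)' ^ 2`, which gives the Hessian relation. The scalar equations follow from the
chain rule.

For the regret, fix a comparator `v` and use the potential `Φ u = D_R(q v ‖ q u)`. By the Hessian
relation its gradient is `-w u`, where `w u = J_q(u)⁻¹ (q v - q u)` is the initial velocity of the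
preimage of the segment from `q u` to `q v`. That curve stays in `K'` because `K` is convex. Hence
`w u` is tangent to `K'`, so the projection costs only second order (`potential_projected_step`),
and convexity of `f` along the segment bounds `⟨∇g u, w u⟩` by `g v - g u`. Each step therefore
lowers `Φ` by at least `η (g (u t) - g v) - O(η²)`. Telescoping gives regret at most `2 D / η + O(η
T)`, and for `η = c T^(-2/3)` both terms are `O(T^(2/3))`. Compactness makes all constants uniform
in `v`. -/

theorem HasDerivAt.le_of_forall_le_add_mul {h : ℝ → ℝ} {h' c : ℝ} (hh : HasDerivAt h h' 0)
    (hle : ∀ s ∈ Ioc (0 : ℝ) 1, h s ≤ h 0 + s * c) : h' ≤ c := by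
  refine le_of_tendsto hh.tendsto_slope_zero_right ?_
  filter_upwards [Ioc_mem_nhdsGT (zero_lt_one' ℝ)] with s hs
  have := hle s hs
  rw [zero_add, smul_eq_mul, inv_mul_le_iff₀ hs.1]
  linarith

section InnerProductSpace

variable {E : Type*} [NormedAddCommGroup E] [InnerProductSpace ℝ E]

theorem inner_sub_nonneg_of_isNearest {K : Set E} (hK : Convex ℝ K) {y p : E} (hp : p ∈ K)
    (hnear : ∀ z ∈ K, ‖y - p‖ ≤ ‖y - z‖) {z : E} (hz : z ∈ K) :
    0 ≤ inner ℝ (p - y) (z - p) := by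
  have hinf : ‖y - p‖ = ⨅ w : K, ‖y - w‖ := by
    have : Nonempty K := ⟨⟨p, hp⟩⟩
    refine le_antisymm (le_ciInf fun w => hnear w w.2) ?_
    exact ciInf_le ⟨0, by rintro _ ⟨w, rfl⟩; exact norm_nonneg _⟩ (⟨p, hp⟩ : K)
  have := (norm_eq_iInf_iff_real_inner_le_zero hK hp).1 hinf z hz
  rw [← neg_sub y p, inner_neg_left]
  linarith

/-- First order expansion of a function whose gradient `-w` is Lipschitz on a convex set. -/
theorem sub_le_of_gradient_lipschitz {K : Set E} (hK : Convex ℝ K) {w : E → E} {Φ : E → ℝ}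
    {L : ℝ} (hL : 0 ≤ L) (hΦ : ∀ u ∈ K, HasFDerivAt Φ (-innerSL ℝ (w u)) u)
    (hw : ∀ u ∈ K, ∀ v ∈ K, ‖w u - w v‖ ≤ L * ‖u - v‖) {u p : E} (hu : u ∈ K) (hp : p ∈ K) :
    Φ p - Φ u ≤ -inner ℝ (w u) (p - u) + L * ‖p - u‖ ^ 2 := by
  have hmem : ∀ s ∈ Icc (0 : ℝ) 1, u + s • (p - u) ∈ K := fun s hs =>
    hK.add_smul_sub_mem hu hp hs
  have hder : ∀ s ∈ Icc (0 : ℝ) 1, HasDerivAt (fun s : ℝ => Φ (u + s • (p - u)))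
      (-inner ℝ (w (u + s • (p - u))) (p - u)) s := by
    intro s hs
    have h1 : HasDerivAt (fun s : ℝ => u + s • (p - u)) (p - u) s := by
      simpa using ((hasDerivAt_id s).smul_const (p - u)).const_add u
    refine ((hΦ _ (hmem s hs)).comp_hasDerivAt s h1).congr_deriv ?_
    simp
  obtain ⟨s, hs, hs'⟩ := exists_hasDerivAt_eq_slope _ _ (zero_lt_one' ℝ)
    (fun s hs => (hder s hs).continuousAt.continuousWithinAt)
    (fun s hs => hder s (Ioo_subset_Icc_self hs))
  simp only [one_smul, add_sub_cancel, zero_smul, add_zero, sub_zero, div_one] at hs'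
  rw [← hs']
  have hbound : ‖w u - w (u + s • (p - u))‖ ≤ L * ‖p - u‖ := by
    refine (hw _ hu _ (hmem s (Ioo_subset_Icc_self hs))).trans ?_
    rw [sub_add_cancel_left, norm_neg, norm_smul, Real.norm_eq_abs, abs_of_pos hs.1]
    exact mul_le_mul_of_nonneg_left (mul_le_of_le_one_left (norm_nonneg _) hs.2.le) hL
  have hcs := real_inner_le_norm (w u - w (u + s • (p - u))) (p - u)
  have := mul_le_mul_of_nonneg_right hbound (norm_nonneg (p - u))
  rw [inner_sub_left] at hcs
  nlinarith

/-- One projected gradient step decreases a potential with gradient `-w` up to second order,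
provided that `w u` lies in the tangent cone of the feasible set at each of its points `u`. -/
theorem potential_projected_step {K : Set E} (hK : Convex ℝ K) {w : E → E} {Φ : E → ℝ}
    {L G η : ℝ} (hL : 0 ≤ L) (hη : 0 ≤ η) (hΦ : ∀ u ∈ K, HasFDerivAt Φ (-innerSL ℝ (w u)) u)
    (hw : ∀ u ∈ K, ∀ v ∈ K, ‖w u - w v‖ ≤ L * ‖u - v‖)
    (htan : ∀ u ∈ K, ∀ δ : E, (∀ z ∈ K, 0 ≤ inner ℝ δ (z - u)) → 0 ≤ inner ℝ δ (w u))
    {u p γ : E} (hu : u ∈ K) (hp : p ∈ K)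
    (hproj : ∀ z ∈ K, ‖u - η • γ - p‖ ≤ ‖u - η • γ - z‖) (hγ : ‖γ‖ ≤ G) :
    Φ p - Φ u ≤ η * inner ℝ γ (w u) + 6 * L * G ^ 2 * η ^ 2 := by
  -- `δ` is the correction made by the projection. It has nonnegative inner product with `K - p`,
  -- and its norm is at most `η * G` since `u` itself competes with `p`.
  set δ : E := p - (u - η • γ) with hδ
  have hΔ : p - u = δ - η • γ := by rw [hδ]; abel
  have hηγ : ‖η • γ‖ ≤ η * G := by
    rw [norm_smul, Real.norm_eq_abs, abs_of_nonneg hη]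
    exact mul_le_mul_of_nonneg_left hγ hη
  have hδn : ‖δ‖ ≤ η * G := by
    have := hproj u hu
    rw [norm_sub_rev] at this
    refine this.trans ?_
    rwa [sub_sub_cancel_left, norm_neg]
  have hΔn : ‖p - u‖ ≤ 2 * (η * G) := by
    rw [hΔ]; linarith [norm_sub_le δ (η • γ)]
  -- Tangency is available at the new point `p`, while the expansion needs `w u`. The Lipschitz
  -- bound makes the exchange at cost `2 L G² η²`; the quadratic remainder adds `4 L G² η²`, whence
  -- the 6.
  have hpos : 0 ≤ inner ℝ δ (w p) :=
    htan p hp δ fun z hz => inner_sub_nonneg_of_isNearest hK hp hproj hz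
  have hcs : inner ℝ δ (w p) - inner ℝ δ (w u) ≤ η * G * (L * (2 * (η * G))) := by
    rw [← inner_sub_right]
    refine (real_inner_le_norm _ _).trans ?_
    refine mul_le_mul hδn ((hw p hp u hu).trans (mul_le_mul_of_nonneg_left hΔn hL))
      (norm_nonneg _) ((norm_nonneg _).trans hδn)
  have hexp := sub_le_of_gradient_lipschitz hK hL hΦ hw hu hp
  have hin : inner ℝ (w u) (p - u) = inner ℝ δ (w u) - η * inner ℝ γ (w u) := by
    rw [hΔ, real_inner_comm, inner_sub_left, real_inner_smul_left]
  have hsq : L * ‖p - u‖ ^ 2 ≤ L * (2 * (η * G)) ^ 2 := by gcongr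
  rw [hin] at hexp
  nlinarith

end InnerProductSpace

theorem exists_lipschitz_bound_of_contDiffOn {E F : Type*} [NormedAddCommGroup E]
    [NormedSpace ℝ E] [NormedAddCommGroup F] [NormedSpace ℝ F] {f : E → F} {U K : Set E}
    (hU : IsOpen U) (hf : ContDiffOn ℝ 1 f U) (hK : Convex ℝ K) (hKc : IsCompact K)
    (hKU : K ⊆ U) : ∃ L : ℝ, 0 ≤ L ∧ ∀ u ∈ K, ∀ v ∈ K, ‖f u - f v‖ ≤ L * ‖u - v‖ := by
  have hcont : ContinuousOn (fderiv ℝ f) K :=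
    (hf.continuousOn_fderiv_of_isOpen hU le_rfl).mono hKU
  obtain ⟨L, hL⟩ := hKc.exists_bound_of_continuousOn hcont
  refine ⟨max L 0, le_max_right _ _, fun u hu v hv => ?_⟩
  exact hK.norm_image_sub_le_of_norm_fderiv_le
    (fun x hx => (hf.contDiffAt (hU.mem_nhds (hKU hx))).differentiableAt one_ne_zero)
    (fun x hx => (hL x hx).trans (le_max_left _ _)) hv hu

/-! ### Primitives on open intervals -/

theorem exists_primitive_of_continuousOn {J : Set ℝ} (hJ : IsOpen J) (hJc : J.OrdConnected)
    {h : ℝ → ℝ} (hh : ContinuousOn h J) : ∃ H : ℝ → ℝ, ∀ x ∈ J, HasDerivAt H (h x) x := by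
  rcases J.eq_empty_or_nonempty with rfl | ⟨a, ha⟩
  · exact ⟨0, by simp⟩
  refine ⟨fun x => ∫ t in a..x, h t, fun x hx => ?_⟩
  refine intervalIntegral.integral_hasDerivAt_right
    (hh.mono (hJc.uIcc_subset ha hx)).intervalIntegrable ?_ (hh.continuousAt (hJ.mem_nhds hx))
  exact hh.stronglyMeasurableAtFilter hJ x hx

theorem contDiffOn_succ_of_hasDerivAt {J : Set ℝ} (hJ : IsOpen J) {n : ℕ} {H h : ℝ → ℝ}
    (hH : ∀ x ∈ J, HasDerivAt H (h x) x) (hh : ContDiffOn ℝ n h J) :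
    ContDiffOn ℝ (n + 1) H J := by
  rw [contDiffOn_succ_iff_deriv_of_isOpen hJ]
  refine ⟨fun x hx => (hH x hx).differentiableAt.differentiableWithinAt, by simp, ?_⟩
  exact hh.congr fun x hx => (hH x hx).deriv

theorem exists_second_primitive {J : Set ℝ} (hJ : IsOpen J) (hJc : J.OrdConnected)
    {n : ℕ} {h : ℝ → ℝ} (hh : ContDiffOn ℝ n h J) :
    ∃ ρ ρ₁ : ℝ → ℝ, ContDiffOn ℝ (n + 2) ρ J ∧ (∀ x ∈ J, HasDerivAt ρ (ρ₁ x) x) ∧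
      ∀ x ∈ J, HasDerivAt ρ₁ (h x) x := by
  obtain ⟨ρ₁, hρ₁⟩ := exists_primitive_of_continuousOn hJ hJc hh.continuousOn
  have h1 := contDiffOn_succ_of_hasDerivAt hJ hρ₁ hh
  obtain ⟨ρ, hρ⟩ := exists_primitive_of_continuousOn hJ hJc h1.continuousOn
  refine ⟨ρ, ρ₁, ?_, hρ, hρ₁⟩
  have h2 := contDiffOn_succ_of_hasDerivAt (n := n + 1) hJ hρ (by exact_mod_cast h1)
  have e : ((n + 1 : ℕ) : WithTop ℕ∞) + 1 = (n : WithTop ℕ∞) + 2 := by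
    push_cast; rw [add_assoc]; norm_num
  rwa [e] at h2

/-! ### Separable functions on Euclidean space -/

section Separable

variable {d : ℕ} {ρ ρ₁ h : Fin d → ℝ → ℝ} {M : Set (Vec d)}

theorem hasFDerivAt_sum_coord {x : Vec d} (hρ : ∀ i, HasDerivAt (ρ i) (ρ₁ i (x i)) (x i)) :
    HasFDerivAt (fun y : Vec d => ∑ i, ρ i (y i))
      (∑ i, ρ₁ i (x i) • (EuclideanSpace.proj i : Vec d →L[ℝ] ℝ)) x := by
  refine HasFDerivAt.fun_sum fun i _ => ?_
  exact (hρ i).comp_hasFDerivAt x (EuclideanSpace.proj (𝕜 := ℝ) i).hasFDerivAt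

theorem bregmanDiv_sum_coord {x y : Vec d} (hρ : ∀ i, HasDerivAt (ρ i) (ρ₁ i (y i)) (y i)) :
    bregmanDiv (fun z : Vec d => ∑ i, ρ i (z i)) x y =
      ∑ i, ρ i (x i) - ∑ i, ρ i (y i) - ∑ i, ρ₁ i (y i) * (x i - y i) := by
  rw [bregmanDiv, inner_gradient_left, (hasFDerivAt_sum_coord hρ).fderiv]
  simp

theorem hasFDerivAt_bregmanDiv_sum_coord (hM : IsOpen M)
    (hρ : ∀ y ∈ M, ∀ i, HasDerivAt (ρ i) (ρ₁ i (y i)) (y i))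
    (hρ₁ : ∀ y ∈ M, ∀ i, HasDerivAt (ρ₁ i) (h i (y i)) (y i)) (x : Vec d) {y : Vec d}
    (hy : y ∈ M) :
    HasFDerivAt (bregmanDiv (fun z : Vec d => ∑ i, ρ i (z i)) x)
      (-∑ i, (h i (y i) * (x i - y i)) • (EuclideanSpace.proj i : Vec d →L[ℝ] ℝ)) y := by
  have hcoord : ∀ i, HasDerivAt (fun s => ρ i (x i) - ρ i s - ρ₁ i s * (x i - s))
      (-(h i (y i) * (x i - y i))) (y i) := by
    intro i
    have := ((hρ y hy i).const_sub (ρ i (x i))).sub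
      ((hρ₁ y hy i).mul ((hasDerivAt_id (y i)).const_sub (x i)))
    refine this.congr_deriv ?_
    simp only [id]
    ring
  have hsum := hasFDerivAt_sum_coord (ρ := fun i s => ρ i (x i) - ρ i s - ρ₁ i s * (x i - s))
    (ρ₁ := fun i s => -(h i s * (x i - s))) hcoord
  have heq : bregmanDiv (fun z : Vec d => ∑ i, ρ i (z i)) x =ᶠ[𝓝 y]
      fun z => ∑ i, (ρ i (x i) - ρ i (z i) - ρ₁ i (z i) * (x i - z i)) := by
    filter_upwards [hM.mem_nhds hy] with z hz
    rw [bregmanDiv_sum_coord (hρ z hz), Finset.sum_sub_distrib, Finset.sum_sub_distrib]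
  refine (hsum.congr_of_eventuallyEq heq).congr_fderiv ?_
  ext v
  simp

theorem hessianMatrix_sum_coord (hM : IsOpen M)
    (hρ : ∀ y ∈ M, ∀ i, HasDerivAt (ρ i) (ρ₁ i (y i)) (y i))
    (hρ₁ : ∀ y ∈ M, ∀ i, HasDerivAt (ρ₁ i) (h i (y i)) (y i)) {x : Vec d} (hx : x ∈ M) :
    hessianMatrix (fun z : Vec d => ∑ i, ρ i (z i)) x = Matrix.diagonal fun i => h i (x i) := by
  have heq : fderiv ℝ (fun z : Vec d => ∑ i, ρ i (z i)) =ᶠ[𝓝 x]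
      fun z => ∑ i, ρ₁ i (z i) • (EuclideanSpace.proj i : Vec d →L[ℝ] ℝ) := by
    filter_upwards [hM.mem_nhds hx] with z hz
    exact (hasFDerivAt_sum_coord (hρ z hz)).fderiv
  have hder : HasFDerivAt
      (fun z : Vec d => ∑ i, ρ₁ i (z i) • (EuclideanSpace.proj i : Vec d →L[ℝ] ℝ))
      (∑ i, (h i (x i) • (EuclideanSpace.proj i : Vec d →L[ℝ] ℝ)).smulRight
        (EuclideanSpace.proj i : Vec d →L[ℝ] ℝ)) x := by
    refine HasFDerivAt.fun_sum fun i _ => ?_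
    have hi : HasFDerivAt (fun z : Vec d => ρ₁ i (z i))
        (h i (x i) • (EuclideanSpace.proj i : Vec d →L[ℝ] ℝ)) x :=
      (hρ₁ x hx i).comp_hasFDerivAt x (EuclideanSpace.proj (𝕜 := ℝ) i).hasFDerivAt
    exact hi.smul_const (EuclideanSpace.proj i : Vec d →L[ℝ] ℝ)
  ext i j
  rw [hessianMatrix, Matrix.of_apply, heq.fderiv_eq, hder.fderiv]
  simp [Matrix.diagonal_apply]

theorem contDiffOn_sum_coord {n : WithTop ℕ∞}
    (hρ : ∀ y ∈ M, ∀ i, ContDiffAt ℝ n (ρ i) (y i)) :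
    ContDiffOn ℝ n (fun z : Vec d => ∑ i, ρ i (z i)) M := by
  intro y hy
  refine ContDiffAt.contDiffWithinAt (ContDiffAt.sum fun i _ => ?_)
  exact (hρ y hy i).comp y (EuclideanSpace.proj (𝕜 := ℝ) i).contDiff.contDiffAt

/-- Subtracting `m / 2 * ‖z‖ ^ 2` preserves separability, so the claim reduces to second derivatives
of one-variable functions on the projections of `K`. -/
theorem strongConvexOn_sum_coord {K : Set (Vec d)} (hK : Convex ℝ K) {m : ℝ}
    (hρ : ∀ y ∈ K, ∀ i, HasDerivAt (ρ i) (ρ₁ i (y i)) (y i))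
    (hρ₁ : ∀ y ∈ K, ∀ i, HasDerivAt (ρ₁ i) (h i (y i)) (y i))
    (hm : ∀ y ∈ K, ∀ i, m ≤ h i (y i)) :
    StrongConvexOn K m (fun z : Vec d => ∑ i, ρ i (z i)) := by
  rw [strongConvexOn_iff_convex]
  have hcoord : ∀ i, ConvexOn ℝ ((EuclideanSpace.proj i : Vec d →L[ℝ] ℝ) '' K)
      (fun s => ρ i s - m / 2 * s ^ 2) := by
    intro i
    have h1 : ∀ s ∈ (EuclideanSpace.proj i : Vec d →L[ℝ] ℝ) '' K,
        HasDerivAt (fun s => ρ i s - m / 2 * s ^ 2) (ρ₁ i s - m * s) s := by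
      rintro _ ⟨y, hy, rfl⟩
      refine ((hρ y hy i).sub ((hasDerivAt_pow 2 (y i)).const_mul (m / 2))).congr_deriv ?_
      simp; ring
    have h2 : ∀ s ∈ (EuclideanSpace.proj i : Vec d →L[ℝ] ℝ) '' K,
        HasDerivAt (fun s => ρ₁ i s - m * s) (h i s - m) s := by
      rintro _ ⟨y, hy, rfl⟩
      refine ((hρ₁ y hy i).sub ((hasDerivAt_id (y i)).const_mul m)).congr_deriv ?_
      simp
    refine convexOn_of_hasDerivWithinAt2_nonneg
      (hK.is_linear_image (EuclideanSpace.proj i : Vec d →L[ℝ] ℝ).isBoundedLinearMap.toIsLinearMap)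
      (fun s hs => (h1 s hs).continuousAt.continuousWithinAt)
      (fun s hs => (h1 s (interior_subset hs)).hasDerivWithinAt)
      (fun s hs => (h2 s (interior_subset hs)).hasDerivWithinAt) fun s hs => ?_
    obtain ⟨y, hy, rfl⟩ := interior_subset hs
    exact sub_nonneg.2 (hm y hy i)
  refine ⟨hK, fun x hx y hy a b ha hb hab => ?_⟩
  have hsplit : ∀ z : Vec d, ∑ i, ρ i (z i) - m / 2 * ‖z‖ ^ 2 =
      ∑ i, (ρ i (z i) - m / 2 * z i ^ 2) := by
    intro z
    rw [EuclideanSpace.norm_sq_eq, Finset.sum_sub_distrib, Finset.mul_sum]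
    simp
  simp only [hsplit, smul_eq_mul, Finset.mul_sum, ← Finset.sum_add_distrib]
  refine Finset.sum_le_sum fun i _ => ?_
  simpa using (hcoord i).2 (mem_image_of_mem _ hx) (mem_image_of_mem _ hy) ha hb hab

end Separable

/-! ### Maps with diagonal Jacobian -/

section Diagonal

variable {d : ℕ}

theorem fderiv_apply_of_isDiag {p : Vec d → Vec d} {u : Vec d}
    (hdiag : (jacobianMatrix p u).IsDiag) (v : Vec d) (i : Fin d) :
    fderiv ℝ p u v i = jacobianMatrix p u i i * v i := by
  have hv : v = ∑ j, v j • EuclideanSpace.single j (1 : ℝ) := by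
    ext k; simp [Pi.single_apply]
  have hoff : ∀ j, j ≠ i → fderiv ℝ p u (EuclideanSpace.single j 1) i = 0 :=
    fun j hj => hdiag hj.symm
  conv_lhs => rw [hv]
  simp only [map_sum, map_smul, WithLp.ofLp_sum, Finset.sum_apply, PiLp.smul_apply, smul_eq_mul]
  rw [Finset.sum_eq_single i (fun j _ hj => by rw [hoff j hj, mul_zero]) (by simp), mul_comm]
  rfl

/-- On a convex thickening of `K`, two points with equal `i`-th coordinate are joined by a segment
along which `p · i` has zero derivative. Without convexity, `p · i` would depend on `u i` only
locally. -/
theorem exists_coordinate_functions {p : Vec d → Vec d} {U K : Set (Vec d)} {n : WithTop ℕ∞}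
    (hn : n ≠ 0) (hU : IsOpen U) (hp : ContDiffOn ℝ n p U)
    (hdiag : ∀ u ∈ U, (jacobianMatrix p u).IsDiag) (hK : Convex ℝ K) (hKc : IsCompact K)
    (hKU : K ⊆ U) :
    ∃ N : Set (Vec d), IsOpen N ∧ Convex ℝ N ∧ K ⊆ N ∧ N ⊆ U ∧ ∃ κ : Fin d → ℝ → ℝ,
      ∀ u ∈ N, ∀ i, p u i = κ i (u i) ∧ ContDiffAt ℝ n (κ i) (u i) ∧
        deriv (κ i) (u i) = jacobianMatrix p u i i := by
  obtain ⟨ε, hε, hεU⟩ := hKc.exists_thickening_subset_open hU hKU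
  set N := Metric.thickening ε K
  have hNo : IsOpen N := Metric.isOpen_thickening
  have hNc : Convex ℝ N := hK.thickening ε
  have hdiff : ∀ u ∈ N, HasFDerivAt p (fderiv ℝ p u) u := fun u hu =>
    ((hp.contDiffAt (hU.mem_nhds (hεU hu))).differentiableAt hn).hasFDerivAt
  have hproj : ∀ (u : Vec d) (i : Fin d), HasFDerivAt (fun v : Vec d => v i)
      (EuclideanSpace.proj i : Vec d →L[ℝ] ℝ) u := fun u i =>
    (EuclideanSpace.proj (𝕜 := ℝ) i).hasFDerivAt
  have hconst : ∀ u ∈ N, ∀ v ∈ N, ∀ i, u i = v i → p u i = p v i := by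
    intro u hu v hv i huv
    have hline : ∀ s : ℝ, HasDerivAt (fun s : ℝ => u + s • (v - u)) (v - u) s := fun s => by
      simpa using ((hasDerivAt_id s).smul_const (v - u)).const_add u
    have hder : ∀ s ∈ Icc (0 : ℝ) 1, HasDerivAt (fun s : ℝ => p (u + s • (v - u)) i) 0 s := by
      intro s hs
      have hm := hNc.add_smul_sub_mem hu hv hs
      have h1 := ((hproj _ i).comp _ (hdiff _ hm)).comp_hasDerivAt s (hline s)
      refine h1.congr_deriv ?_
      have := fderiv_apply_of_isDiag (hdiag _ (hεU hm)) (v - u) i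
      simpa [huv] using this
    obtain ⟨s, hs, hs'⟩ := exists_hasDerivAt_eq_slope _ _ (zero_lt_one' ℝ)
      (fun s hs => (hder s hs).continuousAt.continuousWithinAt)
      (fun s hs => hder s (Ioo_subset_Icc_self hs))
    simp at hs'
    linarith
  classical
  refine ⟨N, hNo, hNc, Metric.self_subset_thickening hε K, hεU,
    -- Any point of `N` with `i`-th coordinate `s` gives the same value; 0 is a junk value off the
    -- projection of `N`.
    fun i s => if h : ∃ u ∈ N, u i = s then p h.choose i else 0, fun u hu i => ?_⟩
  set κ : ℝ → ℝ := fun s => if h : ∃ u ∈ N, u i = s then p h.choose i else 0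
  have hκ : ∀ v ∈ N, p v i = κ (v i) := by
    intro v hv
    have h : ∃ z ∈ N, z i = v i := ⟨v, hv, rfl⟩
    simp only [κ, dif_pos h]
    exact hconst _ hv _ h.choose_spec.1 i h.choose_spec.2.symm
  have hline : ContDiff ℝ n
      (fun s : ℝ => u + (s - u i) • (EuclideanSpace.single i 1 : Vec d)) := by fun_prop
  -- The choice hides regularity, so it is read off from `p` restricted to the line through `u`
  -- parallel to the `i`-th axis.
  have hnear : κ =ᶠ[𝓝 (u i)]
      fun s => p (u + (s - u i) • (EuclideanSpace.single i 1 : Vec d)) i := by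
    have hmem : ∀ᶠ s in 𝓝 (u i), u + (s - u i) • (EuclideanSpace.single i 1 : Vec d) ∈ N := by
      refine hline.continuous.continuousAt.eventually_mem (hNo.mem_nhds ?_)
      simpa using hu
    filter_upwards [hmem] with s hs
    simp [hκ _ hs]
  have hCD : ContDiffAt ℝ n κ (u i) := by
    refine ContDiffAt.congr_of_eventuallyEq ?_ hnear
    refine (EuclideanSpace.proj (𝕜 := ℝ) i).contDiff.contDiffAt.comp (u i)
      (ContDiffAt.comp (u i) ?_ hline.contDiffAt)
    simpa using hp.contDiffAt (hU.mem_nhds (hεU hu))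
  refine ⟨hκ u hu, hCD, ?_⟩
  have h1 : HasFDerivAt (fun v : Vec d => p v i)
      ((EuclideanSpace.proj i : Vec d →L[ℝ] ℝ).comp (fderiv ℝ p u)) u :=
    (hproj _ i).comp _ (hdiff _ hu)
  have h2 : HasFDerivAt (fun v : Vec d => p v i)
      (deriv κ (u i) • (EuclideanSpace.proj i : Vec d →L[ℝ] ℝ)) u := by
    refine ((hCD.differentiableAt hn).hasDerivAt.comp_hasFDerivAt u
      (hproj u i)).congr_of_eventuallyEq ?_
    filter_upwards [hNo.mem_nhds hu] with v hv using hκ v hv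
  have := congrArg (fun A : Vec d →L[ℝ] ℝ => A (EuclideanSpace.single i 1)) (h1.unique h2)
  simpa [jacobianMatrix] using this.symm

theorem jacobianMatrix_mul_of_comp_eq_id {p r : Vec d → Vec d} {u : Vec d}
    (hp : DifferentiableAt ℝ p u) (hr : DifferentiableAt ℝ r (p u))
    (hid : ∀ᶠ v in 𝓝 u, r (p v) = v) (hdiag : (jacobianMatrix p u).IsDiag) (i j : Fin d) :
    jacobianMatrix r (p u) i j * jacobianMatrix p u j j = (1 : Matrix (Fin d) (Fin d) ℝ) i j := by
  have hcomp : HasFDerivAt (fun v => r (p v)) ((fderiv ℝ r (p u)).comp (fderiv ℝ p u)) u :=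
    hr.hasFDerivAt.comp u hp.hasFDerivAt
  have hone := hcomp.unique ((hasFDerivAt_id u).congr_of_eventuallyEq hid)
  have hcol : fderiv ℝ p u (EuclideanSpace.single j 1) =
      jacobianMatrix p u j j • EuclideanSpace.single j 1 := by
    ext k
    rw [fderiv_apply_of_isDiag hdiag]
    by_cases hk : k = j <;> simp [hk]
  have := congrArg (fun A : Vec d →L[ℝ] Vec d => A (EuclideanSpace.single j 1) i) hone
  simp only [ContinuousLinearMap.comp_apply, hcol, map_smul, PiLp.smul_apply, smul_eq_mul] at this
  rw [mul_comm]
  refine this.trans ?_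
  simp [Matrix.one_apply]

end Diagonal

/-! ### Separable regularizers -/

section Regularizer

variable {d : ℕ} {ρ ρ₁ h : Fin d → ℝ → ℝ} {M K : Set (Vec d)}

theorem exists_bound_bregmanDiv_sum_coord (hK : IsCompact K)
    (hρ : ∀ y ∈ K, ∀ i, HasDerivAt (ρ i) (ρ₁ i (y i)) (y i))
    (hρ₁ : ∀ y ∈ K, ∀ i, ContinuousAt (ρ₁ i) (y i)) :
    ∃ D : ℝ, ∀ x ∈ K, ∀ y ∈ K, |bregmanDiv (fun z : Vec d => ∑ i, ρ i (z i)) x y| ≤ D := by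
  have hcoord : ∀ i, Continuous fun z : Vec d => z i := fun i =>
    (EuclideanSpace.proj (𝕜 := ℝ) i).continuous
  have hcont : ContinuousOn (fun z : Vec d × Vec d => ∑ i, ρ i (z.1 i) - ∑ i, ρ i (z.2 i) -
      ∑ i, ρ₁ i (z.2 i) * (z.1 i - z.2 i)) (K ×ˢ K) := by
    intro z hz
    have h1 : ∀ i, Continuous fun z : Vec d × Vec d => z.1 i := fun i =>
      (hcoord i).comp continuous_fst
    have h2 : ∀ i, Continuous fun z : Vec d × Vec d => z.2 i := fun i =>
      (hcoord i).comp continuous_snd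
    refine ContinuousAt.continuousWithinAt (((tendsto_finsetSum _ fun i _ => ?_).sub
      (tendsto_finsetSum _ fun i _ => ?_)).sub (tendsto_finsetSum _ fun i _ => ?_))
    · exact ContinuousAt.comp (f := fun z : Vec d × Vec d => z.1 i) (g := ρ i)
        (hρ z.1 hz.1 i).continuousAt (h1 i).continuousAt
    · exact ContinuousAt.comp (f := fun z : Vec d × Vec d => z.2 i) (g := ρ i)
        (hρ z.2 hz.2 i).continuousAt (h2 i).continuousAt
    · exact (ContinuousAt.comp (f := fun z : Vec d × Vec d => z.2 i) (g := ρ₁ i)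
        (hρ₁ z.2 hz.2 i) (h2 i).continuousAt).mul ((h1 i).sub (h2 i)).continuousAt
  obtain ⟨D, hD⟩ := (hK.prod hK).exists_bound_of_continuousOn hcont
  refine ⟨D, fun x hx y hy => ?_⟩
  rw [bregmanDiv_sum_coord (hρ y hy)]
  exact hD (x, y) ⟨hx, hy⟩

theorem isRegularizer_sum_coord (hM : IsOpen M) (hKM : K ⊆ M) (hK : Convex ℝ K)
    (hKc : IsCompact K) (hC : ∀ y ∈ M, ∀ i, ContDiffAt ℝ 3 (ρ i) (y i))
    (hρ : ∀ y ∈ M, ∀ i, HasDerivAt (ρ i) (ρ₁ i (y i)) (y i))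
    (hρ₁ : ∀ y ∈ M, ∀ i, HasDerivAt (ρ₁ i) (h i (y i)) (y i))
    (hcont : ∀ y ∈ M, ∀ i, ContinuousAt (h i) (y i)) (hpos : ∀ y ∈ M, ∀ i, 0 < h i (y i)) :
    IsRegularizer K (fun z : Vec d => ∑ i, ρ i (z i)) where
  smooth := ⟨M, hM, hKM, contDiffOn_sum_coord hC⟩
  strongConvex := by
    -- Bounding the sum of the reciprocals controls all coordinates at once; the maximum with 1
    -- below keeps the constant positive even when `K` is empty or `d = 0`.
    have hinv : ContinuousOn (fun y : Vec d => ∑ i, (h i (y i))⁻¹) K := by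
      intro y hy
      refine ContinuousAt.continuousWithinAt (tendsto_finsetSum _ fun i _ => ?_)
      exact (ContinuousAt.comp (f := fun y : Vec d => y i) (g := h i) (hcont y (hKM hy) i)
        (EuclideanSpace.proj (𝕜 := ℝ) i).continuous.continuousAt).inv₀ (hpos y (hKM hy) i).ne'
    obtain ⟨B, hB⟩ := hKc.exists_bound_of_continuousOn hinv
    have hB' : 0 < max B 1 := lt_max_of_lt_right one_pos
    refine ⟨(max B 1)⁻¹, inv_pos.2 hB', strongConvexOn_sum_coord hK
      (fun y hy => hρ y (hKM hy)) (fun y hy => hρ₁ y (hKM hy)) fun y hy i => ?_⟩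
    have hyM := hKM hy
    refine inv_le_of_inv_le₀ (hpos y hyM i) ?_
    calc (h i (y i))⁻¹ ≤ ∑ j, (h j (y j))⁻¹ :=
          Finset.single_le_sum (f := fun j => (h j (y j))⁻¹)
            (fun j _ => (inv_pos.2 (hpos y hyM j)).le) (Finset.mem_univ i)
      _ ≤ B := (le_abs_self _).trans (hB y hy)
      _ ≤ max B 1 := le_max_left _ _
  bounded := by
    obtain ⟨D, hD⟩ := exists_bound_bregmanDiv_sum_coord hKc (fun y hy => hρ y (hKM hy))
      fun y hy i => (hρ₁ y (hKM hy) i).continuousAt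
    exact ⟨D, fun x hx y hy => (le_abs_self _).trans (hD x hx y hy)⟩

/-- The projections of the open convex set `M` are open intervals, so primitives exist globally on
them. Since `deriv (ψ i) ^ 2` is `C²`, in particular `C¹`, two integrations reach `C³`. -/
theorem exists_second_primitives_coord (hM : IsOpen M) (hMc : Convex ℝ M)
    {ψ : Fin d → ℝ → ℝ} (hψ : ∀ y ∈ M, ∀ i, ContDiffAt ℝ 3 (ψ i) (y i)) :
    ∃ ρ ρ₁ : Fin d → ℝ → ℝ, ∀ y ∈ M, ∀ i, ContDiffAt ℝ 3 (ρ i) (y i) ∧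
      HasDerivAt (ρ i) (ρ₁ i (y i)) (y i) ∧
      HasDerivAt (ρ₁ i) (deriv (ψ i) (y i) ^ 2) (y i) ∧
      ContinuousAt (fun s => deriv (ψ i) s ^ 2) (y i) := by
  have key : ∀ i, ∃ ρ ρ₁ : ℝ → ℝ, ∀ y ∈ M, ContDiffAt ℝ 3 ρ (y i) ∧
      HasDerivAt ρ (ρ₁ (y i)) (y i) ∧ HasDerivAt ρ₁ (deriv (ψ i) (y i) ^ 2) (y i) ∧
      ContinuousAt (fun s => deriv (ψ i) s ^ 2) (y i) := by
    intro i
    set J : Set ℝ := (EuclideanSpace.proj i : Vec d →L[ℝ] ℝ) '' M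
    have hJ : IsOpen J := (EuclideanSpace.proj i : Vec d →L[ℝ] ℝ).isOpenMap
      (fun s => ⟨EuclideanSpace.single i s, by simp⟩) M hM
    have hJc : J.OrdConnected := (hMc.is_linear_image
      (EuclideanSpace.proj i : Vec d →L[ℝ] ℝ).isBoundedLinearMap.toIsLinearMap).ordConnected
    have hψJ : ContDiffOn ℝ 3 (ψ i) J := by
      rintro _ ⟨y, hy, rfl⟩
      exact (hψ y hy i).contDiffWithinAt
    have hh : ContDiffOn ℝ (1 : ℕ) (fun s => deriv (ψ i) s ^ 2) J :=
      (hψJ.deriv_of_isOpen hJ (by norm_num)).pow 2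
    obtain ⟨ρ, ρ₁, h1, h2, h3⟩ := exists_second_primitive hJ hJc hh
    refine ⟨ρ, ρ₁, fun y hy => ?_⟩
    have hyJ : y i ∈ J := ⟨y, hy, rfl⟩
    refine ⟨?_, h2 _ hyJ, h3 _ hyJ, hh.continuousOn.continuousAt (hJ.mem_nhds hyJ)⟩
    have := h1.contDiffAt (hJ.mem_nhds hyJ)
    norm_num at this
    exact this
  choose ρ ρ₁ hρ using key
  exact ⟨ρ, ρ₁, fun y hy i => hρ i y hy⟩

end Regularizer

/-! ### The scalar equation -/

/-- The terms `ρ₁(κ) κ' κ''` cancel, leaving `κ' (a κ' ^ 2 - 1) = 0`. -/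
theorem deriv_equation_of_comp {κ ρ ρ₁ : ℝ → ℝ} {s a : ℝ} (hκ : ContDiffAt ℝ 2 κ s)
    (hρ : ∀ᶠ t in 𝓝 s, HasDerivAt ρ (ρ₁ (κ t)) (κ t)) (hρ₁ : HasDerivAt ρ₁ a (κ s))
    (ha : a * deriv κ s ^ 2 = 1) :
    deriv κ s * deriv (deriv (ρ ∘ κ)) s - deriv (deriv κ) s * deriv (ρ ∘ κ) s - deriv κ s = 0 := by
  have hκd : ∀ᶠ t in 𝓝 s, DifferentiableAt ℝ κ t := by
    filter_upwards [hκ.eventually (by simp)] with t ht using ht.differentiableAt two_ne_zero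
  have h1 : deriv (ρ ∘ κ) =ᶠ[𝓝 s] fun t => ρ₁ (κ t) * deriv κ t := by
    filter_upwards [hρ, hκd] with t ht ht' using (ht.comp t ht'.hasDerivAt).deriv
  have hκ' : DifferentiableAt ℝ (deriv κ) s := by
    have : ContDiffAt ℝ 1 (fderiv ℝ κ) s := hκ.fderiv_right (by norm_num)
    exact (this.differentiableAt one_ne_zero).clm_apply (differentiableAt_const 1)
  have h2 := (hρ₁.comp s hκd.self_of_nhds.hasDerivAt).mul hκ'.hasDerivAt
  have h3 : deriv (deriv (ρ ∘ κ)) s =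
      a * deriv κ s * deriv κ s + ρ₁ (κ s) * deriv (deriv κ) s := by
    rw [h1.deriv_eq]
    exact h2.deriv
  rw [h3, h1.self_of_nhds]
  linear_combination deriv κ s * ha

/-! ### Regret of online gradient descent after a change of variables -/

section Regret

variable {d : ℕ} {K' : Set (Vec d)} {q : OpenPartialHomeomorph (Vec d) (Vec d)}

/-- The initial velocity of the curve in `K'` that `q` maps to the segment from `q u` to `q v`. -/
def pullbackDirection (q : OpenPartialHomeomorph (Vec d) (Vec d)) (v u : Vec d) : Vec d :=
  fderiv ℝ q.symm (q u) (q v - q u)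

theorem hasDerivAt_pullback_segment (hq_symm : ContDiffOn ℝ 3 q.symm q.target) {u : Vec d}
    (hu : u ∈ q.source) (v : Vec d) :
    HasDerivAt (fun s : ℝ => q.symm (q u + s • (q v - q u))) (pullbackDirection q v u) 0 := by
  have h1 : HasDerivAt (fun s : ℝ => q u + s • (q v - q u)) (q v - q u) 0 := by
    simpa using ((hasDerivAt_id (0 : ℝ)).smul_const (q v - q u)).const_add (q u)
  have h2 : HasFDerivAt q.symm (fderiv ℝ q.symm (q u)) (q u + (0 : ℝ) • (q v - q u)) := by
    rw [zero_smul, add_zero]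
    exact ((hq_symm.contDiffAt (q.open_target.mem_nhds (q.map_source hu))).differentiableAt
      (by norm_num)).hasFDerivAt
  exact h2.comp_hasDerivAt 0 h1

theorem pullback_segment_mem (hK' : K' ⊆ q.source) (hK : Convex ℝ (q '' K')) {u v : Vec d}
    (hu : u ∈ K') (hv : v ∈ K') {s : ℝ} (hs : s ∈ Icc (0 : ℝ) 1) :
    q.symm (q u + s • (q v - q u)) ∈ K' ∧
      q (q.symm (q u + s • (q v - q u))) = q u + s • (q v - q u) := by
  obtain ⟨z, hz, hz'⟩ := hK.add_smul_sub_mem (mem_image_of_mem q hu) (mem_image_of_mem q hv) hs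
  rw [← hz', q.left_inv (hK' hz)]
  exact ⟨hz, rfl⟩

/-- The direction is the one-sided velocity of a curve that starts at `u` and stays in `K'`. -/
theorem inner_pullbackDirection_nonneg (hK' : K' ⊆ q.source) (hK : Convex ℝ (q '' K'))
    (hq_symm : ContDiffOn ℝ 3 q.symm q.target) {u v δ : Vec d} (hu : u ∈ K') (hv : v ∈ K')
    (hδ : ∀ z ∈ K', 0 ≤ inner ℝ δ (z - u)) : 0 ≤ inner ℝ δ (pullbackDirection q v u) := by
  have hder := (innerSL ℝ δ).hasFDerivAt.comp_hasDerivAt 0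
    (hasDerivAt_pullback_segment hq_symm (hK' hu) v)
  have := hder.neg.le_of_forall_le_add_mul (c := 0) fun s hs => ?_
  · simpa using this
  · have := hδ _ (pullback_segment_mem hK' hK hu hv (Ioc_subset_Icc_self hs)).1
    rw [inner_sub_right] at this
    simpa [q.left_inv (hK' hu)] using this

/-- Along the pulled back segment `g` equals the convex function `f` on a straight segment, so its
initial slope is at most the chord slope. -/
theorem inner_gradient_pullbackDirection_le (hK' : K' ⊆ q.source) (hK : Convex ℝ (q '' K'))
    (hq_symm : ContDiffOn ℝ 3 q.symm q.target) {GF : ℝ} {g f : Vec d → ℝ}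
    (hg : IsReparametrizedLoss q K' GF g f) {u v : Vec d} (hu : u ∈ K') (hv : v ∈ K') :
    inner ℝ (gradient g u) (pullbackDirection q v u) ≤ g v - g u := by
  have hgd : HasFDerivAt g (fderiv ℝ g u) (q.symm (q u + (0 : ℝ) • (q v - q u))) := by
    rw [zero_smul, add_zero, q.left_inv (hK' hu)]
    exact (hg.differentiable u hu).hasFDerivAt
  have hder := hgd.comp_hasDerivAt 0 (hasDerivAt_pullback_segment hq_symm (hK' hu) v)
  rw [inner_gradient_left]
  refine hder.le_of_forall_le_add_mul fun s hs => ?_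
  obtain ⟨hm, hqm⟩ := pullback_segment_mem hK' hK hu hv (Ioc_subset_Icc_self hs)
  have hconv := hg.convex.2 (mem_image_of_mem q hu) (mem_image_of_mem q hv)
    (sub_nonneg.2 hs.2) hs.1.le (sub_add_cancel 1 s)
  have hpt : (1 - s) • q u + s • q v = q u + s • (q v - q u) := by module
  rw [hpt, ← hqm, ← hg.comp_eq _ hm, ← hg.comp_eq u hu, ← hg.comp_eq v hv] at hconv
  simp only [smul_eq_mul] at hconv
  simp only [Function.comp, zero_smul, add_zero, q.left_inv (hK' hu)]
  linarith

/-- The direction is affine in `q v`, with coefficients that are `C¹` in `u`; boundedness of `q` on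
`K'` makes the constant uniform in `v`. -/
theorem exists_lipschitz_pullbackDirection (hK'_convex : Convex ℝ K')
    (hK'_compact : IsCompact K') (hK' : K' ⊆ q.source) (hq : ContDiffOn ℝ 3 q q.source)
    (hq_symm : ContDiffOn ℝ 3 q.symm q.target) :
    ∃ L : ℝ, 0 ≤ L ∧ ∀ v ∈ K', ∀ u ∈ K', ∀ u' ∈ K',
      ‖pullbackDirection q v u - pullbackDirection q v u'‖ ≤ L * ‖u - u'‖ := by
  have hA : ContDiffOn ℝ 1 (fun u => fderiv ℝ q.symm (q u)) q.source :=
    (hq_symm.fderiv_of_isOpen q.open_target (by norm_num)).comp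
      (hq.of_le (by norm_num)) q.mapsTo
  have hb : ContDiffOn ℝ 1 (fun u => fderiv ℝ q.symm (q u) (q u)) q.source :=
    hA.clm_apply (hq.of_le (by norm_num))
  obtain ⟨L₁, hL₁, h₁⟩ := exists_lipschitz_bound_of_contDiffOn q.open_source hA hK'_convex
    hK'_compact hK'
  obtain ⟨L₂, hL₂, h₂⟩ := exists_lipschitz_bound_of_contDiffOn q.open_source hb hK'_convex
    hK'_compact hK'
  obtain ⟨B, hB⟩ := hK'_compact.exists_bound_of_continuousOn (hq.continuousOn.mono hK')
  refine ⟨L₁ * max B 0 + L₂, by positivity, fun v hv u hu u' hu' => ?_⟩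
  have hsplit : pullbackDirection q v u - pullbackDirection q v u' =
      (fderiv ℝ q.symm (q u) - fderiv ℝ q.symm (q u')) (q v) -
        (fderiv ℝ q.symm (q u) (q u) - fderiv ℝ q.symm (q u') (q u')) := by
    simp only [pullbackDirection, map_sub, sub_apply]
    abel
  have hfst : ‖(fderiv ℝ q.symm (q u) - fderiv ℝ q.symm (q u')) (q v)‖ ≤
      L₁ * ‖u - u'‖ * max B 0 :=
    (ContinuousLinearMap.le_opNorm _ _).trans (mul_le_mul (h₁ u hu u' hu')
      ((hB v hv).trans (le_max_left _ _)) (norm_nonneg _) (by positivity))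
  rw [hsplit]
  refine (norm_sub_le _ _).trans ?_
  linarith [h₂ u hu u' hu']

theorem sum_Icc_one_sub_succ (a : ℕ → ℝ) (T : ℕ) :
    ∑ t ∈ Finset.Icc 1 T, (a t - a (t + 1)) = a 1 - a (T + 1) := by
  induction T with
  | zero => simp
  | succ n ih => rw [Finset.sum_Icc_succ_top (by lia), ih]; ring

theorem IsOGDRun.mem {η : ℝ} {T : ℕ} {g : ℕ → Vec d → ℝ} {u : ℕ → Vec d}
    (hrun : IsOGDRun K' η T g u) {t : ℕ} (ht : t ∈ Finset.Icc 1 (T + 1)) : u t ∈ K' := by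
  rw [Finset.mem_Icc] at ht
  obtain ⟨n, rfl⟩ : ∃ n, t = n + 1 := ⟨t - 1, by lia⟩
  rcases Nat.eq_zero_or_pos n with rfl | hn
  · exact hrun.1
  · exact (hrun.2 n (Finset.mem_Icc.2 ⟨hn, by lia⟩)).1

/-- A potential `Φ v` with gradient minus the pulled back direction towards `v`, bounded by `D`,
bounds the regret against `v` by `2 D / η + O(η T)`. -/
theorem mul_regret_le_of_potential (hK'_convex : Convex ℝ K') (hK' : K' ⊆ q.source)
    (hK : Convex ℝ (q '' K')) (hq_symm : ContDiffOn ℝ 3 q.symm q.target) {Φ : Vec d → ℝ}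
    {D L GF η : ℝ} {v : Vec d} (hv : v ∈ K') (hL : 0 ≤ L) (hη : 0 ≤ η)
    (hΦ : ∀ u ∈ K', HasFDerivAt Φ (-innerSL ℝ (pullbackDirection q v u)) u)
    (hD : ∀ u ∈ K', |Φ u| ≤ D)
    (hlip : ∀ u ∈ K', ∀ u' ∈ K',
      ‖pullbackDirection q v u - pullbackDirection q v u'‖ ≤ L * ‖u - u'‖)
    {T : ℕ} {g f : ℕ → Vec d → ℝ}
    (hg : ∀ t ∈ Finset.Icc 1 T, IsReparametrizedLoss q K' GF (g t) (f t)) {u : ℕ → Vec d}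
    (hrun : IsOGDRun K' η T g u) :
    η * ∑ t ∈ Finset.Icc 1 T, (g t (u t) - g t v) ≤ 2 * D + T * (6 * L * GF ^ 2 * η ^ 2) := by
  have hstep : ∀ t ∈ Finset.Icc 1 T, η * (g t (u t) - g t v) ≤
      (Φ (u t) - Φ (u (t + 1))) + 6 * L * GF ^ 2 * η ^ 2 := by
    intro t ht
    have hut : u t ∈ K' := hrun.mem (Finset.Icc_subset_Icc_right (Nat.le_succ T) ht)
    have hproj := hrun.2 t ht
    have h1 := potential_projected_step hK'_convex hL hη hΦ hlip
      (fun z hz δ hδ => inner_pullbackDirection_nonneg hK' hK hq_symm hz hv hδ) hut hproj.1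
      hproj.2 ((hg t ht).gradient_le _ hut)
    have h2 := mul_le_mul_of_nonneg_left
      (inner_gradient_pullbackDirection_le hK' hK hq_symm (hg t ht) hut hv) hη
    linarith
  have hsum := Finset.sum_le_sum hstep
  rw [← Finset.mul_sum, Finset.sum_add_distrib, sum_Icc_one_sub_succ (fun t => Φ (u t)),
    Finset.sum_const, Nat.card_Icc, Nat.add_sub_cancel, nsmul_eq_mul] at hsum
  have h1 := (abs_le.1 (hD _ (hrun.mem (t := 1) (Finset.mem_Icc.2 ⟨le_rfl, by lia⟩)))).2
  have h2 := (abs_le.1 (hD _ (hrun.mem (t := T + 1) (Finset.mem_Icc.2 ⟨by lia, le_rfl⟩)))).1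
  linarith

theorem regret_le_of_potential (hK'_convex : Convex ℝ K') (hK' : K' ⊆ q.source)
    (hK : Convex ℝ (q '' K')) (hq_symm : ContDiffOn ℝ 3 q.symm q.target)
    {Φ : Vec d → Vec d → ℝ} {D L GF c : ℝ} (hL : 0 ≤ L) (hc : 0 < c)
    (hΦ : ∀ v ∈ K', ∀ u ∈ K', HasFDerivAt (Φ v) (-innerSL ℝ (pullbackDirection q v u)) u)
    (hD : ∀ v ∈ K', ∀ u ∈ K', |Φ v u| ≤ D)
    (hlip : ∀ v ∈ K', ∀ u ∈ K', ∀ u' ∈ K',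
      ‖pullbackDirection q v u - pullbackDirection q v u'‖ ≤ L * ‖u - u'‖)
    {T : ℕ} (hT : 1 ≤ T) {g f : ℕ → Vec d → ℝ}
    (hg : ∀ t ∈ Finset.Icc 1 T, IsReparametrizedLoss q K' GF (g t) (f t)) {u : ℕ → Vec d}
    (hrun : IsOGDRun K' (c * (T : ℝ) ^ (-(2 / 3) : ℝ)) T g u) :
    regret K' T g u ≤ (2 * D / c + 6 * L * GF ^ 2 * c) * (T : ℝ) ^ (2 / 3 : ℝ) := by
  have hT1 : (1 : ℝ) ≤ T := by exact_mod_cast hT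
  set τ : ℝ := (T : ℝ) ^ (2 / 3 : ℝ) with hτ
  have hτ0 : 0 < τ := Real.rpow_pos_of_pos (by linarith) _
  -- `τ ^ 2 = T ^ (4 / 3)`, so the error `η² T` is at most `c²`.
  have hTτ : (T : ℝ) ≤ τ ^ 2 := by
    rw [hτ, ← Real.rpow_natCast, ← Real.rpow_mul (by linarith)]
    exact Real.self_le_rpow_of_one_le hT1 (by norm_num)
  have hη : c * (T : ℝ) ^ (-(2 / 3) : ℝ) = c / τ := by
    rw [Real.rpow_neg (by linarith), hτ, ← div_eq_mul_inv c]
  rw [hη] at hrun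
  have hbound : ∀ v ∈ K', (∑ t ∈ Finset.Icc 1 T, g t (u t)) -
      (2 * D / c + 6 * L * GF ^ 2 * c) * τ ≤ ∑ t ∈ Finset.Icc 1 T, g t v := by
    intro v hv
    have h := mul_regret_le_of_potential hK'_convex hK' hK hq_symm hv hL (div_pos hc hτ0).le
      (hΦ v hv) (hD v hv) (hlip v hv) hg hrun
    rw [Finset.sum_sub_distrib] at h
    have herr : (T : ℝ) * (6 * L * GF ^ 2 * (c / τ) ^ 2) ≤ 6 * L * GF ^ 2 * c ^ 2 := by
      calc (T : ℝ) * (6 * L * GF ^ 2 * (c / τ) ^ 2) ≤ τ ^ 2 * (6 * L * GF ^ 2 * (c / τ) ^ 2) := by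
            gcongr
        _ = 6 * L * GF ^ 2 * c ^ 2 := by field_simp
    have h' := mul_le_mul_of_nonneg_left (h.trans (add_le_add_right herr _)) (div_pos hτ0 hc).le
    have e1 : ∀ x : ℝ, τ / c * (c / τ * x) = x := fun x => by field_simp
    have e2 : τ / c * (2 * D + 6 * L * GF ^ 2 * c ^ 2) =
        (2 * D / c + 6 * L * GF ^ 2 * c) * τ := by field_simp
    rw [e1, e2] at h'
    linarith
  have hinf := le_csInf (Set.Nonempty.image (fun v => ∑ t ∈ Finset.Icc 1 T, g t v) ⟨u 1, hrun.1⟩)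
    (a := (∑ t ∈ Finset.Icc 1 T, g t (u t)) - (2 * D / c + 6 * L * GF ^ 2 * c) * τ)
    (by rintro _ ⟨v, hv, rfl⟩; exact hbound v hv)
  rw [regret]
  linarith

theorem differentiableOn_of_isReparametrizedLoss (hK' : K' ⊆ q.source)
    (hq_symm : ContDiffOn ℝ 3 q.symm q.target) {GF : ℝ} {g f : Vec d → ℝ}
    (hg : IsReparametrizedLoss q K' GF g f) : DifferentiableOn ℝ f (q '' K') := by
  have hcomp : DifferentiableOn ℝ (g ∘ q.symm) (q '' K') := by
    rintro _ ⟨u, hu, rfl⟩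
    refine DifferentiableAt.differentiableWithinAt (DifferentiableAt.comp _ ?_ ?_)
    · rw [q.left_inv (hK' hu)]
      exact hg.differentiable u hu
    · exact (hq_symm.contDiffAt (q.open_target.mem_nhds
        (q.map_source (hK' hu)))).differentiableAt (by norm_num)
  refine hcomp.congr ?_
  rintro _ ⟨u, hu, rfl⟩
  rw [Function.comp_apply, q.left_inv (hK' hu), hg.comp_eq u hu]

end Regret

/-! ### The regularizer induced by a diagonal change of variables -/

section Induced

variable {d : ℕ} {q : OpenPartialHomeomorph (Vec d) (Vec d)}

theorem jacobianMatrix_symm_mul (hq : ContDiffOn ℝ 3 q q.source)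
    (hq_symm : ContDiffOn ℝ 3 q.symm q.target)
    (hq_diag : ∀ u ∈ q.source, (jacobianMatrix q u).IsDiag) {u : Vec d} (hu : u ∈ q.source)
    (i j : Fin d) : jacobianMatrix q.symm (q u) i j * jacobianMatrix q u j j =
      (1 : Matrix (Fin d) (Fin d) ℝ) i j := by
  refine jacobianMatrix_mul_of_comp_eq_id
    ((hq.contDiffAt (q.open_source.mem_nhds hu)).differentiableAt (by norm_num))
    ((hq_symm.contDiffAt (q.open_target.mem_nhds (q.map_source hu))).differentiableAt
      (by norm_num)) ?_ (hq_diag u hu) i j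
  filter_upwards [q.open_source.mem_nhds hu] with v hv using q.left_inv hv

theorem isDiag_jacobianMatrix_symm (hq : ContDiffOn ℝ 3 q q.source)
    (hq_symm : ContDiffOn ℝ 3 q.symm q.target)
    (hq_diag : ∀ u ∈ q.source, (jacobianMatrix q u).IsDiag) {y : Vec d} (hy : y ∈ q.target) :
    (jacobianMatrix q.symm y).IsDiag := by
  intro i j hij
  have hmul := jacobianMatrix_symm_mul hq hq_symm hq_diag (q.map_target hy)
  rw [q.right_inv hy] at hmul
  have hne : jacobianMatrix q (q.symm y) j j ≠ 0 := by
    intro h0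
    have := hmul j j
    simp [h0] at this
  have := hmul i j
  rw [Matrix.one_apply_ne hij] at this
  exact (mul_eq_zero.1 this).resolve_right hne

/-- The Bregman divergence to a fixed point, pulled back along `q`, has minus the pulled back
direction as its gradient. -/
theorem hasFDerivAt_bregmanDiv_comp (hq : ContDiffOn ℝ 3 q q.source)
    (hq_symm : ContDiffOn ℝ 3 q.symm q.target)
    (hq_diag : ∀ u ∈ q.source, (jacobianMatrix q u).IsDiag) {M : Set (Vec d)} (hM : IsOpen M)
    {ρ ρ₁ h : Fin d → ℝ → ℝ} (hρ : ∀ y ∈ M, ∀ i, HasDerivAt (ρ i) (ρ₁ i (y i)) (y i))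
    (hρ₁ : ∀ y ∈ M, ∀ i, HasDerivAt (ρ₁ i) (h i (y i)) (y i)) {u : Vec d} (hu : u ∈ q.source)
    (huM : q u ∈ M) (hh : ∀ i, h i (q u i) = jacobianMatrix q.symm (q u) i i ^ 2) (v : Vec d) :
    HasFDerivAt (fun z => bregmanDiv (fun z : Vec d => ∑ i, ρ i (z i)) (q v) (q z))
      (-innerSL ℝ (pullbackDirection q v u)) u := by
  have hqd : HasFDerivAt q (fderiv ℝ q u) u :=
    ((hq.contDiffAt (q.open_source.mem_nhds hu)).differentiableAt (by norm_num)).hasFDerivAt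
  refine ((hasFDerivAt_bregmanDiv_sum_coord hM hρ hρ₁ (q v) huM).comp u hqd).congr_fderiv ?_
  ext Δ
  have hsymm := isDiag_jacobianMatrix_symm hq hq_symm hq_diag (q.map_source hu)
  simp only [ContinuousLinearMap.comp_apply, neg_apply, sum_apply, smul_apply,
    PiLp.proj_apply, smul_eq_mul, innerSL_apply_apply, PiLp.inner_apply,
    RCLike.inner_apply, conj_trivial, neg_inj]
  refine Finset.sum_congr rfl fun i _ => ?_
  rw [pullbackDirection, fderiv_apply_of_isDiag hsymm, fderiv_apply_of_isDiag (hq_diag u hu), hh,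
    PiLp.sub_apply]
  have hone := jacobianMatrix_symm_mul hq hq_symm hq_diag hu i i
  rw [Matrix.one_apply_eq] at hone
  -- With `a` and `b` the diagonal entries of the Jacobians of `q.symm` and `q`, the chain rule
  -- produces `a² b`, and `a b = 1` reduces it to `a`.
  linear_combination (jacobianMatrix q.symm (q u) i i * (q v i - q u i) * Δ i) * hone

end Induced

end

theorem theorem2 {d : ℕ} (K' : Set (Vec d)) (hK'_convex : Convex ℝ K') (hK'_compact : IsCompact K')
    (q : OpenPartialHomeomorph (Vec d) (Vec d)) (hK'_source : K' ⊆ q.source)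
    (hq : ContDiffOn ℝ 3 q q.source) (hq_symm : ContDiffOn ℝ 3 q.symm q.target)
    (hq_diag : ∀ u ∈ q.source, (jacobianMatrix q u).IsDiag)
    (hK_convex : Convex ℝ (q '' K')) (hK_compact : IsCompact (q '' K')) :
    ∃ R : Vec d → ℝ,
      IsRegularizer (q '' K') R ∧
      HessianJacobianRelation q K' (q '' K') R ∧
      SolvesCoordinateODEs q K' R ∧
      ∀ GF : ℝ, 0 ≤ GF → ∀ c : ℝ, 0 < c →
        ∃ C : ℝ, ∀ T : ℕ, 1 ≤ T → ∀ g f : ℕ → Vec d → ℝ,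
          (∀ t ∈ Finset.Icc 1 T, IsReparametrizedLoss q K' GF (g t) (f t)) →
          IsOMDObject (q '' K') R T f ∧
          ∀ u : ℕ → Vec d, IsOGDRun K' (c * (T : ℝ) ^ (-(2 / 3) : ℝ)) T g u →
            regret K' T g u ≤ C * (T : ℝ) ^ (2 / 3 : ℝ) := by
  obtain ⟨N, hNo, -, hK'N, -, κ, hκ⟩ := exists_coordinate_functions three_ne_zero q.open_source hq
    hq_diag hK'_convex hK'_compact hK'_source
  have hKt : q '' K' ⊆ q.target := by
    rintro _ ⟨u, hu, rfl⟩
    exact q.map_source (hK'_source hu)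
  obtain ⟨M, hMo, hMc, hKM, hMt, ψ, hψ⟩ := exists_coordinate_functions three_ne_zero q.open_target
    hq_symm (fun y hy => isDiag_jacobianMatrix_symm hq hq_symm hq_diag hy) hK_convex hK_compact hKt
  obtain ⟨ρ, ρ₁, hρ⟩ := exists_second_primitives_coord hMo hMc fun y hy i => (hψ y hy i).2.1
  have hone : ∀ u ∈ q.source, ∀ i,
      jacobianMatrix q.symm (q u) i i * jacobianMatrix q u i i = 1 := fun u hu i => by
    simpa using jacobianMatrix_symm_mul hq hq_symm hq_diag hu i i
  have hqM : ∀ u ∈ K', q u ∈ M := fun u hu => hKM (Set.mem_image_of_mem q hu)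
  have hψ' : ∀ u ∈ K', ∀ i, deriv (ψ i) (q u i) = jacobianMatrix q.symm (q u) i i :=
    fun u hu i => (hψ _ (hqM u hu) i).2.2
  have hpos : ∀ y ∈ M, ∀ i, 0 < deriv (ψ i) (y i) ^ 2 := by
    intro y hy i
    have := hone _ (q.map_target (hMt hy)) i
    rw [q.right_inv (hMt hy), ← (hψ y hy i).2.2] at this
    exact sq_pos_of_ne_zero (left_ne_zero_of_mul_eq_one this)
  have hd : ∀ y ∈ M, ∀ i, HasDerivAt (ρ i) (ρ₁ i (y i)) (y i) := fun y hy i => (hρ y hy i).2.1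
  have hd₁ : ∀ y ∈ M, ∀ i, HasDerivAt (ρ₁ i) (deriv (ψ i) (y i) ^ 2) (y i) :=
    fun y hy i => (hρ y hy i).2.2.1
  have hreg : IsRegularizer (q '' K') (fun z : Vec d => ∑ i, ρ i (z i)) :=
    isRegularizer_sum_coord (h := fun i s => deriv (ψ i) s ^ 2) hMo hKM hK_convex hK_compact
      (fun y hy i => (hρ y hy i).1) hd hd₁ (fun y hy i => (hρ y hy i).2.2.2) hpos
  refine ⟨fun z => ∑ i, ρ i (z i), hreg, ⟨⟨Set.mapsTo_image q K', q.injOn.mono hK'_source,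
    Set.surjOn_image q K'⟩, fun u hu => ?_⟩, ⟨κ, ρ, ⟨N, hNo, hK'N, fun u hu i => (hκ u hu i).1⟩,
    fun _ => rfl, ?_⟩, fun GF _ c hc => ?_⟩
  · rw [hessianMatrix_sum_coord (h := fun i s => deriv (ψ i) s ^ 2) hMo hd hd₁ (hqM u hu)]
    have hJ : jacobianMatrix q u = Matrix.diagonal fun i => jacobianMatrix q u i i :=
      ((hq_diag u (hK'_source hu)).diagonal_diag).symm
    rw [hJ, Matrix.diagonal_transpose, Matrix.diagonal_mul_diagonal]
    refine Matrix.inv_eq_right_inv ?_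
    rw [Matrix.diagonal_mul_diagonal, ← Matrix.diagonal_one]
    congr 1
    ext i
    rw [hψ' u hu i]
    linear_combination (jacobianMatrix q.symm (q u) i i * jacobianMatrix q u i i + 1) *
      hone u (hK'_source hu) i
  · rintro i _ ⟨u, hu, rfl⟩
    obtain ⟨hqu, hκC, hκ'⟩ := hκ u (hK'N hu) i
    dsimp only
    refine ⟨hκC, hqu ▸ (hρ _ (hqM u hu) i).1, ?_⟩
    have hline : Continuous
        (fun s : ℝ => u + (s - u i) • (EuclideanSpace.single i 1 : Vec d)) := by fun_prop
    -- Moving along the axis realises every `s` near `u i` as a coordinate of a point of `N` whose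
    -- image lies in `M`, so `ρ i` is differentiable at `κ i s`.
    have hmem : ∀ᶠ s in nhds (u i),
        u + (s - u i) • (EuclideanSpace.single i 1 : Vec d) ∈ N ∩ q ⁻¹' M := by
      refine hline.continuousAt.eventually_mem ?_
      simpa using Filter.inter_mem (hNo.mem_nhds (hK'N hu))
        ((q.continuousAt (hK'_source hu)).preimage_mem_nhds (hMo.mem_nhds (hqM u hu)))
    refine deriv_equation_of_comp (ρ₁ := ρ₁ i) (hκC.of_le (by norm_num)) ?_
      (hqu ▸ hd₁ _ (hqM u hu) i) ?_
    · filter_upwards [hmem] with s hs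
      have hκs := (hκ _ hs.1 i).1
      have hds := hd _ hs.2 i
      rw [hκs] at hds
      simpa using hds
    · rw [← hqu, hψ' u hu i, hκ']
      linear_combination (jacobianMatrix q.symm (q u) i i * jacobianMatrix q u i i + 1) *
        hone u (hK'_source hu) i
  · obtain ⟨L, hL, hlip⟩ := exists_lipschitz_pullbackDirection hK'_convex hK'_compact hK'_source hq
      hq_symm
    obtain ⟨D, hD⟩ := exists_bound_bregmanDiv_sum_coord hK_compact (fun y hy => hd y (hKM hy))
      fun y hy i => (hd₁ y (hKM hy) i).continuousAt
    refine ⟨2 * D / c + 6 * L * GF ^ 2 * c, fun T hT g f hg => ⟨⟨hK_convex, hK_compact,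
      fun t ht => (hg t ht).convex,
      fun t ht => differentiableOn_of_isReparametrizedLoss hK'_source hq_symm (hg t ht), hreg⟩,
      fun u hrun => ?_⟩⟩
    refine regret_le_of_potential hK'_convex hK'_source hK_convex hq_symm hL hc
      (fun v _ u hu => ?_)
      (fun v hv u hu => hD _ (Set.mem_image_of_mem q hv) _ (Set.mem_image_of_mem q hu))
      hlip hT hg hrun
    exact hasFDerivAt_bregmanDiv_comp (h := fun i s => deriv (ψ i) s ^ 2) hq hq_symm hq_diag hMo hd
      hd₁ (hK'_source hu) (hqM u hu) (fun i => by rw [hψ' u hu i]) v
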